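/- Let $G$ be a compact quantum group. Let $\mathrm{Rep}(G)$ be the monoidal dagger category of finite-dimensional continuous unitary representations of $G$ and intertwiners (equivalently, of finite-dimensional unitary corepresentations of the Hopf $*$-algebra spanned by the matrix coefficients of the finite-dimensional unitary representations of $G$), and let $\mathrm{Hilb}$ be the monoidal dagger category of finite-dimensional complex Hilbert spaces and linear maps; in both categories the dagger is the adjoint. A *fibre functor* is a $\mathbb{C}$-linear unitary monoidal functor $F:\mathrm{Rep}(G)\to\mathrm{Hilb}$, that is, a $\mathbb{C}$-linear strong monoidal functor with $F(f^\dagger)=F(f)^\dagger$ for all morphisms $f$, whose structure isomorphisms $F(X)\otimes F(Y)\cong F(X\otimes Y)$ and $\mathbb{C}\cong F(\mathbb{1})$ are unitary. Let $\mathrm{Fun}(\mathrm{Rep}(G),\mathrm{Hilb})$ be the following dagger 2-category. Its objects are the fibre functors. A 1-morphism $(\alpha,H):F_1\to F_2$ is a unitary pseudonatural transformation: a finite-dimensional Hilbert space $H$ together with a unitary $\alpha_X:F_1(X)\otimes H\to H\otimes F_2(X)$ for every object $X$ of $\mathrm{Rep}(G)$, natural in $X$ and compatible with the monoidal structures of $F_1$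 and $F_2$ (for tensor products and for the unit object). A 2-morphism $(\alpha,H)\to(\beta,H')$ is a modification: a linear map $f:H\to H'$ such that $(f\otimes \mathrm{id}_{F_2(X)})\circ\alpha_X=\beta_X\circ(\mathrm{id}_{F_1(X)}\otimes f)$ for all $X$; its dagger is the adjoint of $f$. The composite $\alpha\otimes\beta$ of $(\alpha,H):F_1\to F_2$ and $(\beta,K):F_2\to F_3$ has underlying Hilbert space $H\otimes K$ and components $(\mathrm{id}_H\otimes\beta_X)\circ(\alpha_X\otimes\mathrm{id}_K)$. A 2-morphism $f$ is *unitary* if $f^\dagger\circ f$ and $f\circ f^\dagger$ are identities. A *dagger equivalence* between objects $r,s$ of a dagger 2-category is a 1-morphism $E:r\to s$ for which there are a 1-morphism $E^{-1}:s\to r$ and unitary 2-morphisms $\eta:\mathrm{id}_s\to E^{-1}\otimes E$ and $\epsilon:E\otimes E^{-1}\to\mathrm{id}_r$. **Proposition.** For fibre functors $F_1,F_2:\mathrm{Rep}(G)\to\mathrm{Hilb}$, there exists a dagger equivalence $F_1\to F_2$ in $\mathrm{Fun}(\mathrm{Rep}(G),\mathrm{Hilb})$ if and only if $F_1$ and $F_2$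 are unitarily monoidally naturally isomorphic, i.e. there is a monoidal natural isomorphism $F_1\to F_2$ all of whose components are unitary. -/

import Mathlib

open CategoryTheory

universe w₁ w₂ v₁ v₂ u₁ u₂ u

/-! ### Dagger 2-categories -/

section

open Bicategory

/-- A dagger 2-category: every hom-category is a dagger category, and the dagger is compatible
with the composition of 1-morphisms.  As bicategories need not be strict here, the structural
2-isomorphisms are required to be unitary (for a strict 2-category this is automatic). -/
class DaggerBicategory (B : Type u₁) [Bicategory.{w₁, v₁} B] where
  /-- The dagger of a 2-morphism. -/
  dagger {a b : B} {f g : a ⟶ b} : (f ⟶ g) → (g ⟶ f)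
  dagger_id {a b : B} (f : a ⟶ b) : dagger (𝟙 f) = 𝟙 f
  dagger_comp {a b : B} {f g h : a ⟶ b} (η : f ⟶ g) (θ : g ⟶ h) :
    dagger (η ≫ θ) = dagger θ ≫ dagger η
  dagger_dagger {a b : B} {f g : a ⟶ b} (η : f ⟶ g) : dagger (dagger η) = η
  dagger_whiskerLeft {a b c : B} (f : a ⟶ b) {g h : b ⟶ c} (η : g ⟶ h) :
    dagger (f ◁ η) = f ◁ dagger η
  dagger_whiskerRight {a b c : B} {f g : a ⟶ b} (η : f ⟶ g) (h : b ⟶ c) :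
    dagger (η ▷ h) = dagger η ▷ h
  dagger_associator {a b c d : B} (f : a ⟶ b) (g : b ⟶ c) (h : c ⟶ d) :
    dagger (α_ f g h).hom = (α_ f g h).inv
  dagger_leftUnitor {a b : B} (f : a ⟶ b) : dagger (λ_ f).hom = (λ_ f).inv
  dagger_rightUnitor {a b : B} (f : a ⟶ b) : dagger (ρ_ f).hom = (ρ_ f).inv

namespace DaggerBicategory

section

variable {B : Type u₁} [Bicategory.{w₁, v₁} B] [DaggerBicategory B]

/-- A 2-morphism is unitary if it is both an isometry and a coisometry. -/
def IsUnitary {a b : B} {f g : a ⟶ b} (η : f ⟶ g) : Prop :=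
  η ≫ dagger η = 𝟙 f ∧ dagger η ≫ η = 𝟙 g

/-- A 1-morphism `X : r ⟶ s` is a dagger equivalence if it has a weak inverse, witnessed by
unitary 2-morphisms. -/
def IsDaggerEquivalence {r s : B} (X : r ⟶ s) : Prop :=
  ∃ (Y : s ⟶ r) (η : 𝟙 s ⟶ Y ≫ X) (θ : X ≫ Y ⟶ 𝟙 r), IsUnitary η ∧ IsUnitary θ

/-- Two objects are dagger equivalent if there is a dagger equivalence between them. -/
def DaggerEquivalent (r s : B) : Prop :=
  ∃ X : r ⟶ s, IsDaggerEquivalence X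

theorem isUnitary_of_iso {a b : B} {f g : a ⟶ b} (e : f ≅ g) (h : dagger e.hom = e.inv) :
    IsUnitary e.hom := by
  simp [IsUnitary, h]

theorem IsUnitary.dagger_hom {a b : B} {f g : a ⟶ b} {e : f ≅ g} (h : IsUnitary e.hom) :
    dagger e.hom = e.inv := by
  rw [← cancel_epi e.hom, h.1, e.hom_inv_id]

theorem IsUnitary.comp {a b : B} {f g h : a ⟶ b} {η : f ⟶ g} {θ : g ⟶ h}
    (hη : IsUnitary η) (hθ : IsUnitary θ) : IsUnitary (η ≫ θ) := by
  constructor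
  · rw [dagger_comp, Category.assoc, ← Category.assoc θ, hθ.1, Category.id_comp, hη.1]
  · rw [dagger_comp, Category.assoc, ← Category.assoc _ η, hη.2, Category.id_comp, hθ.2]

theorem IsUnitary.dagger {a b : B} {f g : a ⟶ b} {η : f ⟶ g} (hη : IsUnitary η) :
    IsUnitary (dagger η) := by
  refine ⟨?_, ?_⟩ <;> rw [dagger_dagger]
  exacts [hη.2, hη.1]

theorem IsUnitary.inv {a b : B} {f g : a ⟶ b} {e : f ≅ g} (h : IsUnitary e.hom) :
    IsUnitary e.inv := by
  rw [← h.dagger_hom]; exact h.dagger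

theorem IsUnitary.whiskerLeft {a b c : B} (f : a ⟶ b) {g h : b ⟶ c} {η : g ⟶ h}
    (hη : IsUnitary η) : IsUnitary (f ◁ η) := by
  constructor
  · rw [dagger_whiskerLeft, ← Bicategory.whiskerLeft_comp, hη.1, Bicategory.whiskerLeft_id]
  · rw [dagger_whiskerLeft, ← Bicategory.whiskerLeft_comp, hη.2, Bicategory.whiskerLeft_id]

theorem IsUnitary.whiskerRight {a b c : B} {f g : a ⟶ b} {η : f ⟶ g} (hη : IsUnitary η)
    (h : b ⟶ c) : IsUnitary (η ▷ h) := by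
  constructor
  · rw [dagger_whiskerRight, ← Bicategory.comp_whiskerRight, hη.1, Bicategory.id_whiskerRight]
  · rw [dagger_whiskerRight, ← Bicategory.comp_whiskerRight, hη.2, Bicategory.id_whiskerRight]

theorem isUnitary_associator {a b c d : B} (f : a ⟶ b) (g : b ⟶ c) (h : c ⟶ d) :
    IsUnitary (α_ f g h).hom := isUnitary_of_iso _ (dagger_associator f g h)

theorem isUnitary_leftUnitor {a b : B} (f : a ⟶ b) : IsUnitary (λ_ f).hom :=
  isUnitary_of_iso _ (dagger_leftUnitor f)

theorem isUnitary_rightUnitor {a b : B} (f : a ⟶ b) : IsUnitary (ρ_ f).hom :=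
  isUnitary_of_iso _ (dagger_rightUnitor f)

end

end DaggerBicategory

open DaggerBicategory

/-! ### The dagger 2-category `Fun(B, C)` -/

/-- A unitary pseudofunctor between dagger 2-categories. -/
structure UnitaryPseudofunctor (B : Type u₁) [Bicategory.{w₁, v₁} B] [DaggerBicategory B]
    (C : Type u₂) [Bicategory.{w₂, v₂} C] [DaggerBicategory C] extends Pseudofunctor B C where
  map₂_dagger {a b : B} {f g : a ⟶ b} (η : f ⟶ g) : map₂ (dagger η) = dagger (map₂ η)
  mapId_unitary (a : B) : IsUnitary (mapId a).hom
  mapComp_unitary {a b c : B} (f : a ⟶ b) (g : b ⟶ c) : IsUnitary (mapComp f g).hom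

namespace UnitaryPseudofunctor

open Pseudofunctor.StrongTrans

variable {B : Type u₁} [Bicategory.{w₁, v₁} B] [DaggerBicategory B]
  {C : Type u₂} [Bicategory.{w₂, v₂} C] [DaggerBicategory C]

/-- A unitary pseudonatural transformation: a pseudonatural transformation
`F(X) ≫ α_s ≅ α_r ≫ G(X)` all of whose 2-morphism components are unitary. -/
structure UPT (F G : UnitaryPseudofunctor B C) where
  /-- The underlying pseudonatural transformation. -/
  trans : F.toPseudofunctor ⟶ G.toPseudofunctor
  unitary {a b : B} (f : a ⟶ b) : IsUnitary (trans.naturality f).hom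

/-- 1-morphisms are unitary pseudonatural transformations, with the usual composition. -/
instance : CategoryStruct (UnitaryPseudofunctor B C) where
  Hom F G := UPT F G
  id F :=
    { trans := 𝟙 F.toPseudofunctor
      unitary f := by
        rw [categoryStruct_id_naturality_hom]
        exact (isUnitary_rightUnitor _).comp (isUnitary_leftUnitor _).inv }
  comp α β :=
    { trans := α.trans ≫ β.trans
      unitary f := by
        rw [categoryStruct_comp_naturality_hom]
        exact (isUnitary_associator _ _ _).inv.comp <| ((α.unitary f).whiskerRight _).comp <|
          (isUnitary_associator _ _ _).comp <| ((β.unitary f).whiskerLeft _).comp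
          (isUnitary_associator _ _ _).inv }

/-- 2-morphisms are modifications. -/
@[ext]
structure Hom₂ {F G : UnitaryPseudofunctor B C} (α β : F ⟶ G) where
  /-- The underlying modification. -/
  modification : α.trans ⟶ β.trans

instance (F G : UnitaryPseudofunctor B C) : Category (F ⟶ G) where
  Hom α β := Hom₂ α β
  id α := ⟨𝟙 α.trans⟩
  comp Γ Θ := ⟨Γ.modification ≫ Θ.modification⟩

@[ext]
theorem hom₂_ext {F G : UnitaryPseudofunctor B C} {α β : F ⟶ G} {Γ Θ : α ⟶ β}
    (h : Γ.modification = Θ.modification) : Γ = Θ :=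
  Hom₂.ext h

/-- An invertible modification between the underlying transformations is an isomorphism. -/
def isoMk {F G : UnitaryPseudofunctor B C} {α β : F ⟶ G} (e : α.trans ≅ β.trans) : α ≅ β where
  hom := ⟨e.hom⟩
  inv := ⟨e.inv⟩
  hom_inv_id := hom₂_ext e.hom_inv_id
  inv_hom_id := hom₂_ext e.inv_hom_id

/-- The 2-category of unitary pseudofunctors, unitary pseudonatural transformations and
modifications; all compositions are those of the 2-category of pseudofunctors. -/
instance : Bicategory (UnitaryPseudofunctor B C) where
  whiskerLeft α _ _ Γ := Hom₂.mk (α.trans ◁ Hom₂.modification Γ)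
  whiskerRight Γ β := Hom₂.mk (Hom₂.modification Γ ▷ β.trans)
  associator α β γ := isoMk (α_ α.trans β.trans γ.trans)
  leftUnitor α := isoMk (λ_ α.trans)
  rightUnitor α := isoMk (ρ_ α.trans)
  whiskerLeft_id _ _ := hom₂_ext (Bicategory.whiskerLeft_id _ _)
  whiskerLeft_comp _ _ _ _ _ _ := hom₂_ext (Bicategory.whiskerLeft_comp _ _ _)
  id_whiskerLeft _ := hom₂_ext (Bicategory.id_whiskerLeft _)
  comp_whiskerLeft _ _ _ _ _ := hom₂_ext (Bicategory.comp_whiskerLeft _ _ _)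
  id_whiskerRight _ _ := hom₂_ext (Bicategory.id_whiskerRight _ _)
  comp_whiskerRight _ _ _ := hom₂_ext (Bicategory.comp_whiskerRight _ _ _)
  whiskerRight_id _ := hom₂_ext (Bicategory.whiskerRight_id _)
  whiskerRight_comp _ _ _ := hom₂_ext (Bicategory.whiskerRight_comp _ _ _)
  whisker_assoc _ _ _ _ _ := hom₂_ext (Bicategory.whisker_assoc _ _ _)
  whisker_exchange _ _ := hom₂_ext (Bicategory.whisker_exchange _ _)
  pentagon _ _ _ _ := hom₂_ext (Bicategory.pentagon _ _ _ _)
  triangle _ _ := hom₂_ext (Bicategory.triangle _ _)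

/-- The componentwise dagger of a modification between unitary transformations. -/
def daggerModification {F G : UnitaryPseudofunctor B C} {α β : F ⟶ G}
    (Γ : Modification α.trans β.trans) : Modification β.trans α.trans where
  app a := dagger (Γ.app a)
  naturality {a b} f := by
    have h := congrArg dagger (Γ.naturality f)
    simp only [dagger_comp, dagger_whiskerLeft, dagger_whiskerRight,
      (α.unitary f).dagger_hom, (β.unitary f).dagger_hom] at h
    rw [← cancel_epi (β.trans.naturality f).inv, ← Category.assoc, h]
    simp

/-- The dagger of a modification is taken componentwise. -/
instance : DaggerBicategory (UnitaryPseudofunctor B C) where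
  dagger Γ := Hom₂.mk ⟨daggerModification (Hom₂.modification Γ).as⟩
  dagger_id _ := hom₂_ext (homCategory.ext fun _ => dagger_id _)
  dagger_comp _ _ := hom₂_ext (homCategory.ext fun _ => dagger_comp _ _)
  dagger_dagger _ := hom₂_ext (homCategory.ext fun _ => dagger_dagger _)
  dagger_whiskerLeft _ _ _ _ := hom₂_ext (homCategory.ext fun _ => dagger_whiskerLeft _ _)
  dagger_whiskerRight _ _ := hom₂_ext (homCategory.ext fun _ => dagger_whiskerRight _ _)
  dagger_associator _ _ _ := hom₂_ext (homCategory.ext fun _ => dagger_associator _ _ _)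
  dagger_leftUnitor _ := hom₂_ext (homCategory.ext fun _ => dagger_leftUnitor _)
  dagger_rightUnitor _ := hom₂_ext (homCategory.ext fun _ => dagger_rightUnitor _)

end UnitaryPseudofunctor

/-- A full sub-2-category of a dagger 2-category is a dagger 2-category. -/
instance {X : Type*} {B : Type u₁} [Bicategory.{w₁, v₁} B] [DaggerBicategory B] (φ : X → B) :
    DaggerBicategory (InducedBicategory B φ) where
  dagger η := ⟨dagger η.hom⟩
  dagger_id _ := InducedBicategory.hom₂_ext (dagger_id _)
  dagger_comp _ _ := InducedBicategory.hom₂_ext (dagger_comp _ _)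
  dagger_dagger _ := InducedBicategory.hom₂_ext (dagger_dagger _)
  dagger_whiskerLeft _ _ _ _ := InducedBicategory.hom₂_ext (dagger_whiskerLeft _ _)
  dagger_whiskerRight _ _ := InducedBicategory.hom₂_ext (dagger_whiskerRight _ _)
  dagger_associator _ _ _ := InducedBicategory.hom₂_ext (dagger_associator _ _ _)
  dagger_leftUnitor _ := InducedBicategory.hom₂_ext (dagger_leftUnitor _)
  dagger_rightUnitor _ := InducedBicategory.hom₂_ext (dagger_rightUnitor _)

end

/-! ### Monoidal dagger categories as one-object dagger 2-categories -/

section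

open MonoidalCategory

/-- A monoidal dagger category. -/
class DaggerMonoidalCategory (C : Type u₁) [Category.{v₁} C] [MonoidalCategory C] where
  /-- The dagger of a morphism. -/
  dagger {X Y : C} : (X ⟶ Y) → (Y ⟶ X)
  dagger_id (X : C) : dagger (𝟙 X) = 𝟙 X
  dagger_comp {X Y Z : C} (f : X ⟶ Y) (g : Y ⟶ Z) : dagger (f ≫ g) = dagger g ≫ dagger f
  dagger_dagger {X Y : C} (f : X ⟶ Y) : dagger (dagger f) = f
  dagger_tensor {X X' Y Y' : C} (f : X ⟶ X') (g : Y ⟶ Y') :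
    dagger (f ⊗ₘ g) = dagger f ⊗ₘ dagger g
  dagger_associator (X Y Z : C) : dagger (α_ X Y Z).hom = (α_ X Y Z).inv
  dagger_leftUnitor (X : C) : dagger (λ_ X).hom = (λ_ X).inv
  dagger_rightUnitor (X : C) : dagger (ρ_ X).hom = (ρ_ X).inv

namespace DaggerMonoidalCategory

/-- Unitary morphisms of a (monoidal) dagger category. -/
def IsUnitaryHom {C : Type u₁} [Category.{v₁} C] [MonoidalCategory C] [DaggerMonoidalCategory C]
    {X Y : C} (f : X ⟶ Y) : Prop :=
  f ≫ dagger f = 𝟙 X ∧ dagger f ≫ f = 𝟙 Y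

/-- A monoidal dagger category is a dagger 2-category with one object. -/
instance (C : Type u₁) [Category.{v₁} C] [MonoidalCategory C] [DaggerMonoidalCategory C] :
    DaggerBicategory (MonoidalSingleObj C) where
  dagger {_ _ X Y} f := DaggerMonoidalCategory.dagger (C := C) (X := X) (Y := Y) f
  dagger_id X := DaggerMonoidalCategory.dagger_id (C := C) X
  dagger_comp f g := DaggerMonoidalCategory.dagger_comp (C := C) f g
  dagger_dagger f := DaggerMonoidalCategory.dagger_dagger (C := C) f
  dagger_whiskerLeft X _ _ f := by
    have h := DaggerMonoidalCategory.dagger_tensor (C := C) (𝟙 X) f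
    rw [DaggerMonoidalCategory.dagger_id, id_tensorHom, id_tensorHom] at h
    exact h
  dagger_whiskerRight f Z := by
    have h := DaggerMonoidalCategory.dagger_tensor (C := C) f (𝟙 Z)
    rw [DaggerMonoidalCategory.dagger_id, tensorHom_id, tensorHom_id] at h
    exact h
  dagger_associator X Y Z := DaggerMonoidalCategory.dagger_associator (C := C) X Y Z
  dagger_leftUnitor X := DaggerMonoidalCategory.dagger_leftUnitor (C := C) X
  dagger_rightUnitor X := DaggerMonoidalCategory.dagger_rightUnitor (C := C) X

end DaggerMonoidalCategory

end

/-! ### Finite-dimensional Hilbert spaces -/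

section

open MonoidalCategory
open scoped TensorProduct

/-- A finite-dimensional complex Hilbert space. -/
structure FdHilb where
  /-- The underlying space. -/
  carrier : Type
  [normedAddCommGroup : NormedAddCommGroup carrier]
  [innerProductSpace : InnerProductSpace ℂ carrier]
  [finiteDimensional : FiniteDimensional ℂ carrier]

namespace FdHilb

instance : CoeSort FdHilb Type := ⟨FdHilb.carrier⟩

attribute [instance] normedAddCommGroup innerProductSpace finiteDimensional

/-- Morphisms are linear maps. -/
noncomputable instance : Category FdHilb where
  Hom V W := V →ₗ[ℂ] W
  id V := LinearMap.id
  comp f g := LinearMap.comp g f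

noncomputable instance : Preadditive FdHilb where
  homGroup V W := inferInstanceAs (AddCommGroup (V →ₗ[ℂ] W))
  add_comp _ _ _ f f' g := LinearMap.comp_add f f' g
  comp_add _ _ _ f g g' := LinearMap.add_comp f g' g

noncomputable instance : Linear ℂ FdHilb where
  homModule V W := inferInstanceAs (Module ℂ (V →ₗ[ℂ] W))
  smul_comp _ _ _ r f g := LinearMap.comp_smul g r f
  comp_smul _ _ _ f r g := LinearMap.smul_comp r g f

/-- A linear equivalence as an isomorphism. -/
noncomputable def isoOfEquiv {V W : FdHilb} (e : V ≃ₗ[ℂ] W) : V ≅ W where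
  hom := e.toLinearMap
  inv := e.symm.toLinearMap
  hom_inv_id := LinearMap.ext fun x => e.symm_apply_apply x
  inv_hom_id := LinearMap.ext fun x => e.apply_symm_apply x

/-- The tensor product of Hilbert spaces, with unit `ℂ`. -/
noncomputable instance : MonoidalCategoryStruct FdHilb where
  tensorObj V W := ⟨V ⊗[ℂ] W⟩
  whiskerLeft V _ _ f := LinearMap.lTensor V f
  whiskerRight f W := LinearMap.rTensor W f
  tensorHom f g := TensorProduct.map f g
  tensorUnit := ⟨ℂ⟩
  associator U V W := isoOfEquiv (TensorProduct.assoc ℂ U V W)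
  leftUnitor V := isoOfEquiv (TensorProduct.lid ℂ V)
  rightUnitor V := isoOfEquiv (TensorProduct.rid ℂ V)

theorem assoc_nat {V₁ V₂ V₃ W₁ W₂ W₃ : FdHilb} (f₁ : V₁ →ₗ[ℂ] W₁) (f₂ : V₂ →ₗ[ℂ] W₂)
    (f₃ : V₃ →ₗ[ℂ] W₃) :
    (TensorProduct.assoc ℂ W₁ W₂ W₃).toLinearMap ∘ₗ
        TensorProduct.map (TensorProduct.map f₁ f₂) f₃ =
      TensorProduct.map f₁ (TensorProduct.map f₂ f₃) ∘ₗ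
        (TensorProduct.assoc ℂ V₁ V₂ V₃).toLinearMap :=
  TensorProduct.ext_threefold fun _ _ _ => rfl

theorem pentagon_aux (U V W X : FdHilb) :
    TensorProduct.map LinearMap.id (TensorProduct.assoc ℂ V W X).toLinearMap ∘ₗ
      (TensorProduct.assoc ℂ U (V ⊗[ℂ] W) X).toLinearMap ∘ₗ
        TensorProduct.map (TensorProduct.assoc ℂ U V W).toLinearMap LinearMap.id =
      (TensorProduct.assoc ℂ U V (W ⊗[ℂ] X)).toLinearMap ∘ₗ
        (TensorProduct.assoc ℂ (U ⊗[ℂ] V) W X).toLinearMap :=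
  TensorProduct.ext_fourfold fun _ _ _ _ => rfl

theorem triangle_aux (V W : FdHilb) :
    TensorProduct.map LinearMap.id (TensorProduct.lid ℂ W).toLinearMap ∘ₗ
      (TensorProduct.assoc ℂ V ℂ W).toLinearMap =
      TensorProduct.map (TensorProduct.rid ℂ V).toLinearMap (LinearMap.id : W →ₗ[ℂ] W) :=
  TensorProduct.ext_threefold fun v z w => (TensorProduct.smul_tmul z v w).symm

theorem left_nat {V W : FdHilb} (f : V →ₗ[ℂ] W) :
    (TensorProduct.lid ℂ W).toLinearMap ∘ₗ TensorProduct.map LinearMap.id f =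
      f ∘ₗ (TensorProduct.lid ℂ V).toLinearMap :=
  TensorProduct.ext' fun z v => (f.map_smul z v).symm

theorem right_nat {V W : FdHilb} (f : V →ₗ[ℂ] W) :
    (TensorProduct.rid ℂ W).toLinearMap ∘ₗ TensorProduct.map f LinearMap.id =
      f ∘ₗ (TensorProduct.rid ℂ V).toLinearMap :=
  TensorProduct.ext' fun v z => (f.map_smul z v).symm

noncomputable instance : MonoidalCategory FdHilb :=
  MonoidalCategory.ofTensorHom
    (id_tensorHom_id := fun V W => TensorProduct.map_id (R := ℂ) (M := V) (N := W))
    (id_tensorHom := fun _ _ _ _ => rfl)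
    (tensorHom_id := fun _ _ => rfl)
    (tensorHom_comp_tensorHom := fun {X₁ Y₁ Z₁ X₂ Y₂ Z₂} f₁ f₂ g₁ g₂ =>
      (TensorProduct.map_comp (M := X₁) (M₂ := Y₁) (M₃ := Z₁) (N := X₂) (N₂ := Y₂) (N₃ := Z₂)
        g₁ g₂ f₁ f₂).symm)
    (associator_naturality := fun f₁ f₂ f₃ => assoc_nat f₁ f₂ f₃)
    (leftUnitor_naturality := fun f => left_nat f)
    (rightUnitor_naturality := fun f => right_nat f)
    (pentagon := fun U V W X => pentagon_aux U V W X)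
    (triangle := fun V W => triangle_aux V W)

theorem adjoint_isometryEquiv {V W : FdHilb} (e : V ≃ₗᵢ[ℂ] W) :
    LinearMap.adjoint e.toLinearEquiv.toLinearMap = e.symm.toLinearEquiv.toLinearMap :=
  LinearIsometryEquiv.adjoint_toLinearMap_eq_symm e

/-- The dagger of a linear map is its adjoint. -/
noncomputable instance : DaggerMonoidalCategory FdHilb where
  dagger {V W} f := LinearMap.adjoint (𝕜 := ℂ) (E := V) (F := W) f
  dagger_id V := LinearMap.adjoint_id (𝕜 := ℂ) (E := V)
  dagger_comp {U V W} f g := LinearMap.adjoint_comp (𝕜 := ℂ) (E := U) (F := V) (G := W) g f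
  dagger_dagger {V W} f := LinearMap.adjoint_adjoint (𝕜 := ℂ) (E := V) (F := W) f
  dagger_tensor {V V' W W'} f g :=
    TensorProduct.adjoint_map (𝕜 := ℂ) (E := V) (F := V') (G := W) (H := W') f g
  dagger_associator U V W := adjoint_isometryEquiv
    (V := ⟨(U ⊗[ℂ] V) ⊗[ℂ] W⟩) (W := ⟨U ⊗[ℂ] (V ⊗[ℂ] W)⟩) (TensorProduct.assocIsometry ℂ U V W)
  dagger_leftUnitor V := adjoint_isometryEquiv
    (V := ⟨ℂ ⊗[ℂ] V⟩) (W := V) (TensorProduct.lidIsometry ℂ V)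
  dagger_rightUnitor V := adjoint_isometryEquiv
    (V := ⟨V ⊗[ℂ] ℂ⟩) (W := V) (TensorProduct.ridIsometry ℂ V)

end FdHilb

end

/-! ### Compact quantum groups and their unitary representations -/

section

open scoped TensorProduct

namespace Corep

set_option linter.unusedSectionVars false

section Contract

variable {V W : Type*} [NormedAddCommGroup V] [InnerProductSpace ℂ V]
  [NormedAddCommGroup W] [InnerProductSpace ℂ W]
  {M N : Type*} [AddCommGroup M] [Module ℂ M] [AddCommGroup N] [Module ℂ N]

/-- The linear map `V ⊗ M → M`, `x ⊗ m ↦ ⟪v, x⟫ m`. -/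
noncomputable def contract (M : Type*) [AddCommGroup M] [Module ℂ M] (v : V) :
    V ⊗[ℂ] M →ₗ[ℂ] M :=
  (TensorProduct.lid ℂ M).toLinearMap ∘ₗ LinearMap.rTensor M (innerₛₗ ℂ v)

@[simp]
theorem contract_tmul (v x : V) (m : M) : contract M v (x ⊗ₜ m) = (inner ℂ v x : ℂ) • m := by
  simp [contract]

theorem contract_sum {ι : Type*} [Fintype ι] (b : OrthonormalBasis ι ℂ V) (t : V ⊗[ℂ] M) :
    ∑ i, b i ⊗ₜ[ℂ] contract M (b i) t = t := by
  induction t with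
  | zero => simp
  | add x y hx hy => simp [TensorProduct.tmul_add, Finset.sum_add_distrib, hx, hy]
  | tmul x m =>
    simp only [contract_tmul, ← TensorProduct.smul_tmul]
    rw [← TensorProduct.sum_tmul, b.sum_repr' x]

theorem contract_ext {ι : Type*} [Fintype ι] (b : OrthonormalBasis ι ℂ V) {s t : V ⊗[ℂ] M}
    (h : ∀ i, contract M (b i) s = contract M (b i) t) : s = t := by
  rw [← contract_sum b s, ← contract_sum b t]
  simp [h]

theorem contract_lTensor (v : V) (f : M →ₗ[ℂ] N) (t : V ⊗[ℂ] M) :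
    contract N v (LinearMap.lTensor V f t) = f (contract M v t) := by
  induction t with
  | zero => simp
  | add x y hx hy => simp [hx, hy]
  | tmul x m => simp

theorem contract_assoc (v : V) (s : V ⊗[ℂ] M) (n : N) :
    contract (M ⊗[ℂ] N) v (TensorProduct.assoc ℂ V M N (s ⊗ₜ n)) = contract M v s ⊗ₜ n := by
  induction s with
  | zero => simp
  | add x y hx hy => simp [TensorProduct.add_tmul, hx, hy]
  | tmul x m => simp [TensorProduct.smul_tmul']

theorem contract_rTensor [FiniteDimensional ℂ V] [FiniteDimensional ℂ W] (w : W)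
    (f : V →ₗ[ℂ] W) (t : V ⊗[ℂ] M) :
    contract M w (LinearMap.rTensor M f t) = contract M (LinearMap.adjoint f w) t := by
  induction t with
  | zero => simp
  | add x y hx hy => simp [hx, hy]
  | tmul x m => simp [LinearMap.adjoint_inner_left]

theorem contract_add (v w : V) (t : V ⊗[ℂ] M) :
    contract M (v + w) t = contract M v t + contract M w t := by
  simp [contract, LinearMap.rTensor_add]

theorem contract_smul (z : ℂ) (v : V) (t : V ⊗[ℂ] M) :
    contract M (z • v) t = star z • contract M v t := by
  simp [contract, LinearMap.rTensor_smul]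

end Contract

variable {A : Type*} [Ring A] [HopfAlgebra ℂ A]

section Coaction

variable {V W : Type*} [NormedAddCommGroup V] [InnerProductSpace ℂ V]
  [NormedAddCommGroup W] [InnerProductSpace ℂ W]

/-- The matrix coefficient of a coaction `ρ : V → V ⊗ A` at the vectors `v`, `w`. -/
noncomputable def coeff (ρ : V →ₗ[ℂ] V ⊗[ℂ] A) (v w : V) : A :=
  contract A v (ρ w)

/-- The matrix of coefficients of a coaction with respect to an orthonormal basis. -/
noncomputable def coeffMatrix {ι : Type*} [Fintype ι] (ρ : V →ₗ[ℂ] V ⊗[ℂ] A)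
    (b : OrthonormalBasis ι ℂ V) : Matrix ι ι A :=
  Matrix.of fun i j => coeff ρ (b i) (b j)

/-- `(ρ ⊗ id) ρ = (id ⊗ Δ) ρ`. -/
def IsCoassociative (ρ : V →ₗ[ℂ] V ⊗[ℂ] A) : Prop :=
  (TensorProduct.assoc ℂ V A A).toLinearMap ∘ₗ LinearMap.rTensor A ρ ∘ₗ ρ =
    LinearMap.lTensor V (Coalgebra.comul (R := ℂ) (A := A)) ∘ₗ ρ

/-- `(id ⊗ ε) ρ = id`. -/
def IsCounital (ρ : V →ₗ[ℂ] V ⊗[ℂ] A) : Prop :=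
  (TensorProduct.rid ℂ V).toLinearMap ∘ₗ
    LinearMap.lTensor V (Coalgebra.counit (R := ℂ) (A := A)) ∘ₗ ρ = LinearMap.id

variable {ι : Type*} [Fintype ι] [DecidableEq ι] (b : OrthonormalBasis ι ℂ V)

theorem contract_coaction (ρ : V →ₗ[ℂ] V ⊗[ℂ] A) (v w : V) :
    contract (A ⊗[ℂ] A) v (TensorProduct.assoc ℂ V A A (LinearMap.rTensor A ρ (ρ w))) =
      ∑ k, coeff ρ v (b k) ⊗ₜ[ℂ] coeff ρ (b k) w := by
  conv_lhs => rw [← contract_sum b (ρ w)]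
  simp [contract_assoc, coeff]

theorem isCoassociative_iff (ρ : V →ₗ[ℂ] V ⊗[ℂ] A) :
    IsCoassociative ρ ↔ ∀ i j, Coalgebra.comul (R := ℂ) (coeff ρ (b i) (b j)) =
      ∑ k, coeff ρ (b i) (b k) ⊗ₜ[ℂ] coeff ρ (b k) (b j) := by
  constructor
  · intro h i j
    have := congrArg (contract (A ⊗[ℂ] A) (b i)) (LinearMap.congr_fun h (b j))
    simp only [LinearMap.comp_apply, LinearEquiv.coe_coe, contract_lTensor] at this
    rw [contract_coaction b] at this
    exact this.symm
  · intro h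
    refine b.toBasis.ext fun j => contract_ext b fun i => ?_
    simp only [OrthonormalBasis.coe_toBasis, LinearMap.comp_apply, LinearEquiv.coe_coe,
      contract_lTensor]
    rw [contract_coaction b]
    exact (h i j).symm

theorem contract_rid (v : V) (t : V ⊗[ℂ] ℂ) :
    (inner ℂ v (TensorProduct.rid ℂ V t) : ℂ) = contract ℂ v t := by
  induction t with
  | zero => simp
  | add x y hx hy => simp [hx, hy]
  | tmul x m => simp [mul_comm]

theorem isCounital_iff (ρ : V →ₗ[ℂ] V ⊗[ℂ] A) :
    IsCounital ρ ↔ ∀ i j, Coalgebra.counit (R := ℂ) (coeff ρ (b i) (b j)) =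
      if i = j then (1 : ℂ) else 0 := by
  have key : ∀ i j, (inner ℂ (b i) ((TensorProduct.rid ℂ V)
      (LinearMap.lTensor V (Coalgebra.counit (R := ℂ) (A := A)) (ρ (b j)))) : ℂ) =
      Coalgebra.counit (R := ℂ) (coeff ρ (b i) (b j)) := fun i j => by
    rw [contract_rid, contract_lTensor]; rfl
  constructor
  · intro h i j
    have := LinearMap.congr_fun h (b j)
    simp only [LinearMap.comp_apply, LinearEquiv.coe_coe, LinearMap.id_apply] at this
    rw [← key, this, b.inner_eq_ite]
  · intro h
    refine b.toBasis.ext fun j => ?_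
    refine InnerProductSpace.ext_inner_left_basis b.toBasis fun i => ?_
    simp only [OrthonormalBasis.coe_toBasis, LinearMap.comp_apply, LinearEquiv.coe_coe,
      LinearMap.id_apply]
    rw [key, h, b.inner_eq_ite]

variable [StarRing A] [StarModule ℂ A]

theorem antipode_mul_matrix {ρ : V →ₗ[ℂ] V ⊗[ℂ] A} (h₁ : IsCoassociative ρ)
    (h₂ : IsCounital ρ) :
    (coeffMatrix ρ b).map (HopfAlgebra.antipode ℂ) * coeffMatrix ρ b = 1 := by
  ext i j
  have h := HopfAlgebra.mul_antipode_rTensor_comul_apply (R := ℂ) (coeff ρ (b i) (b j))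
  rw [(isCoassociative_iff b ρ).1 h₁, (isCounital_iff b ρ).1 h₂] at h
  simp only [map_sum, LinearMap.rTensor_tmul, LinearMap.mul'_apply] at h
  rw [Matrix.mul_apply, Matrix.one_apply]
  simp only [coeffMatrix, Matrix.map_apply, Matrix.of_apply]
  rw [h]; split_ifs <;> simp

theorem matrix_mul_antipode {ρ : V →ₗ[ℂ] V ⊗[ℂ] A} (h₁ : IsCoassociative ρ)
    (h₂ : IsCounital ρ) :
    coeffMatrix ρ b * (coeffMatrix ρ b).map (HopfAlgebra.antipode ℂ) = 1 := by
  ext i j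
  have h := HopfAlgebra.mul_antipode_lTensor_comul_apply (R := ℂ) (coeff ρ (b i) (b j))
  rw [(isCoassociative_iff b ρ).1 h₁, (isCounital_iff b ρ).1 h₂] at h
  simp only [map_sum, LinearMap.lTensor_tmul, LinearMap.mul'_apply] at h
  rw [Matrix.mul_apply, Matrix.one_apply]
  simp only [coeffMatrix, Matrix.map_apply, Matrix.of_apply]
  rw [h]; split_ifs <;> simp

/-- The coefficient matrix is unitary if and only if `S(u_ij) = u_ji^*`. -/
theorem unitary_iff {ρ : V →ₗ[ℂ] V ⊗[ℂ] A} (h₁ : IsCoassociative ρ) (h₂ : IsCounital ρ) :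
    coeffMatrix ρ b ∈ unitary (Matrix ι ι A) ↔
      ∀ i j, HopfAlgebra.antipode ℂ (coeff ρ (b i) (b j)) = star (coeff ρ (b j) (b i)) := by
  have hl := antipode_mul_matrix b h₁ h₂
  have hr := matrix_mul_antipode b h₁ h₂
  trans (coeffMatrix ρ b).map (HopfAlgebra.antipode ℂ) = star (coeffMatrix ρ b)
  · rw [Unitary.mem_iff]
    constructor
    · rintro ⟨h, -⟩
      exact (left_inv_eq_right_inv h hr).symm
    · intro h
      rw [← h]
      exact ⟨hl, hr⟩
  · constructor
    · intro h i j
      exact congrFun (congrFun h i) j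
    · intro h
      ext i j
      exact h i j

theorem coeff_eq_sum (ρ : V →ₗ[ℂ] V ⊗[ℂ] A) (v w : V) :
    coeff ρ v w = ∑ i, ∑ j, (star (inner ℂ (b i) v : ℂ) * (inner ℂ (b j) w : ℂ)) •
      coeff ρ (b i) (b j) := by
  have hv : ∀ t : V ⊗[ℂ] A, contract A v t =
      ∑ i, star (inner ℂ (b i) v : ℂ) • contract A (b i) t := fun t => by
    conv_lhs => rw [← contract_sum b t]
    simp
  rw [coeff, hv]
  conv_lhs => rw [← b.sum_repr' w]
  simp [coeff, Finset.smul_sum, smul_smul]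

theorem antipode_coeff {ρ : V →ₗ[ℂ] V ⊗[ℂ] A}
    (h : ∀ i j, HopfAlgebra.antipode ℂ (coeff ρ (b i) (b j)) = star (coeff ρ (b j) (b i)))
    (v w : V) : HopfAlgebra.antipode ℂ (coeff ρ v w) = star (coeff ρ w v) := by
  rw [coeff_eq_sum b ρ v w, coeff_eq_sum b ρ w v, Finset.sum_comm]
  simp only [map_sum, map_smul, h, star_sum, star_smul, star_mul, star_star]

end Coaction

section Tensor

/-- The map `(V ⊗ A) ⊗ (W ⊗ A) → (V ⊗ W) ⊗ A` multiplying the two factors `A`. -/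
noncomputable def merge (A : Type*) [Ring A] [HopfAlgebra ℂ A] (V W : Type*) [AddCommGroup V]
    [Module ℂ V] [AddCommGroup W] [Module ℂ W] :
    (V ⊗[ℂ] A) ⊗[ℂ] (W ⊗[ℂ] A) →ₗ[ℂ] (V ⊗[ℂ] W) ⊗[ℂ] A :=
  LinearMap.lTensor (V ⊗[ℂ] W) (LinearMap.mul' ℂ A) ∘ₗ
    (TensorProduct.tensorTensorTensorComm ℂ V A W A).toLinearMap

/-- The tensor product of two coactions. -/
noncomputable def tensorCoaction {V W : Type*} [AddCommGroup V] [Module ℂ V] [AddCommGroup W]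
    [Module ℂ W] (ρ : V →ₗ[ℂ] V ⊗[ℂ] A) (σ : W →ₗ[ℂ] W ⊗[ℂ] A) :
    V ⊗[ℂ] W →ₗ[ℂ] (V ⊗[ℂ] W) ⊗[ℂ] A :=
  merge A V W ∘ₗ TensorProduct.map ρ σ

section

variable {U V W V' W' : Type*} [AddCommGroup U] [Module ℂ U] [AddCommGroup V] [Module ℂ V]
  [AddCommGroup W] [Module ℂ W] [AddCommGroup V'] [Module ℂ V'] [AddCommGroup W'] [Module ℂ W']

@[simp]
theorem merge_tmul (v : V) (a : A) (w : W) (a' : A) :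
    merge A V W ((v ⊗ₜ a) ⊗ₜ (w ⊗ₜ a')) = (v ⊗ₜ w) ⊗ₜ (a * a') := by
  simp [merge]

@[simp]
theorem tensorCoaction_tmul (ρ : V →ₗ[ℂ] V ⊗[ℂ] A) (σ : W →ₗ[ℂ] W ⊗[ℂ] A) (v : V) (w : W) :
    tensorCoaction ρ σ (v ⊗ₜ w) = merge A V W (ρ v ⊗ₜ σ w) := by
  simp [tensorCoaction]

theorem merge_map (f : V →ₗ[ℂ] V') (g : W →ₗ[ℂ] W') (s : V ⊗[ℂ] A) (t : W ⊗[ℂ] A) :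
    LinearMap.rTensor A (TensorProduct.map f g) (merge A V W (s ⊗ₜ t)) =
      merge A V' W' (LinearMap.rTensor A f s ⊗ₜ LinearMap.rTensor A g t) := by
  induction s with
  | zero => simp
  | add x y hx hy => simp [TensorProduct.add_tmul, hx, hy]
  | tmul v a =>
    induction t with
    | zero => simp
    | add x y hx hy => simp [TensorProduct.tmul_add, hx, hy]
    | tmul w a' => simp

theorem merge_assoc (r : U ⊗[ℂ] A) (s : V ⊗[ℂ] A) (t : W ⊗[ℂ] A) :
    LinearMap.rTensor A (TensorProduct.assoc ℂ U V W).toLinearMap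
        (merge A (U ⊗[ℂ] V) W (merge A U V (r ⊗ₜ s) ⊗ₜ t)) =
      merge A U (V ⊗[ℂ] W) (r ⊗ₜ merge A V W (s ⊗ₜ t)) := by
  induction r with
  | zero => simp
  | add x y hx hy => simp [TensorProduct.add_tmul, hx, hy]
  | tmul u a =>
    induction s with
    | zero => simp
    | add x y hx hy => simp [TensorProduct.add_tmul, TensorProduct.tmul_add, hx, hy]
    | tmul v a' =>
      induction t with
      | zero => simp
      | add x y hx hy => simp only [TensorProduct.tmul_add, map_add, hx, hy]
      | tmul w a'' => simp [mul_assoc]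

theorem merge_lid (z : ℂ) (t : V ⊗[ℂ] A) :
    LinearMap.rTensor A (TensorProduct.lid ℂ V).toLinearMap
      (merge A ℂ V ((z ⊗ₜ 1) ⊗ₜ t)) = z • t := by
  induction t with
  | zero => simp
  | add x y hx hy => simp [TensorProduct.tmul_add, hx, hy]
  | tmul v a => simp [TensorProduct.smul_tmul']

theorem merge_rid (z : ℂ) (t : V ⊗[ℂ] A) :
    LinearMap.rTensor A (TensorProduct.rid ℂ V).toLinearMap
      (merge A V ℂ (t ⊗ₜ (z ⊗ₜ 1))) = z • t := by
  induction t with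
  | zero => simp
  | add x y hx hy => simp [TensorProduct.add_tmul, hx, hy]
  | tmul v a => simp [TensorProduct.smul_tmul']

end

variable {V W : Type*} [NormedAddCommGroup V] [InnerProductSpace ℂ V]
  [NormedAddCommGroup W] [InnerProductSpace ℂ W]

theorem contract_merge (v : V) (w : W) (s : V ⊗[ℂ] A) (t : W ⊗[ℂ] A) :
    contract A (v ⊗ₜ[ℂ] w) (merge A V W (s ⊗ₜ t)) = contract A v s * contract A w t := by
  induction s with
  | zero => simp
  | add x y hx hy => simp [TensorProduct.add_tmul, add_mul, hx, hy]
  | tmul v a =>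
    induction t with
    | zero => simp
    | add x y hx hy => simp [TensorProduct.tmul_add, mul_add, hx, hy]
    | tmul w a' => simp [smul_smul, mul_comm]

theorem coeff_tensor (ρ : V →ₗ[ℂ] V ⊗[ℂ] A) (σ : W →ₗ[ℂ] W ⊗[ℂ] A) (v v' : V) (w w' : W) :
    coeff (tensorCoaction ρ σ) (v ⊗ₜ[ℂ] w) (v' ⊗ₜ[ℂ] w') = coeff ρ v v' * coeff σ w w' := by
  rw [coeff, tensorCoaction_tmul, contract_merge, coeff, coeff]

end Tensor

end Corep

open Corep MonoidalCategory

/-- The finite-dimensional unitary corepresentations of the Hopf `*`-algebra `A`: a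
finite-dimensional Hilbert space with a coassociative and counital coaction of `A` whose matrix of
coefficients (in an orthonormal basis) is unitary. -/
structure UnitaryCorep (A : Type*) [Ring A] [StarRing A] [HopfAlgebra ℂ A] where
  /-- The underlying Hilbert space. -/
  space : FdHilb
  /-- The coaction. -/
  coaction : space →ₗ[ℂ] space ⊗[ℂ] A
  coassoc : IsCoassociative coaction
  counit : IsCounital coaction
  unitary : coeffMatrix coaction (stdOrthonormalBasis ℂ space) ∈ unitary (Matrix _ _ A)

set_option linter.unusedSectionVars false

namespace UnitaryCorep

variable {A : Type*} [Ring A] [StarRing A] [HopfAlgebra ℂ A] [StarModule ℂ A]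

theorem antipode_coeff (X : UnitaryCorep A) (v w : X.space) :
    HopfAlgebra.antipode ℂ (coeff X.coaction v w) = star (coeff X.coaction w v) :=
  Corep.antipode_coeff _ ((unitary_iff _ X.coassoc X.counit).1 X.unitary) v w

/-- The conditions on a corepresentation may be checked in any orthonormal basis. -/
noncomputable def ofBasis (V : FdHilb) (ρ : V →ₗ[ℂ] V ⊗[ℂ] A) {ι : Type*} [Fintype ι]
    [DecidableEq ι] (b : OrthonormalBasis ι ℂ V)
    (h₁ : ∀ i j, Coalgebra.comul (R := ℂ) (coeff ρ (b i) (b j)) =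
      ∑ k, coeff ρ (b i) (b k) ⊗ₜ[ℂ] coeff ρ (b k) (b j))
    (h₂ : ∀ i j, Coalgebra.counit (R := ℂ) (coeff ρ (b i) (b j)) = if i = j then (1 : ℂ) else 0)
    (h₃ : ∀ i j, HopfAlgebra.antipode ℂ (coeff ρ (b i) (b j)) = star (coeff ρ (b j) (b i))) :
    UnitaryCorep A where
  space := V
  coaction := ρ
  coassoc := (isCoassociative_iff b ρ).2 h₁
  counit := (isCounital_iff b ρ).2 h₂
  unitary := (unitary_iff _ ((isCoassociative_iff b ρ).2 h₁) ((isCounital_iff b ρ).2 h₂)).2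
    fun _ _ => Corep.antipode_coeff b h₃ _ _

/-- The intertwiners between two corepresentations. -/
noncomputable def intertwiners (X Y : UnitaryCorep A) : Submodule ℂ (X.space →ₗ[ℂ] Y.space) where
  carrier := {f | LinearMap.rTensor A f ∘ₗ X.coaction = Y.coaction ∘ₗ f}
  add_mem' {f g} hf hg := by
    simp only [Set.mem_ofPred_eq] at *
    rw [LinearMap.rTensor_add, LinearMap.add_comp, LinearMap.comp_add, hf, hg]
  zero_mem' := by
    simp only [Set.mem_ofPred_eq]
    rw [LinearMap.rTensor_zero, LinearMap.zero_comp, LinearMap.comp_zero]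
  smul_mem' r f hf := by
    simp only [Set.mem_ofPred_eq] at *
    rw [LinearMap.rTensor_smul, LinearMap.smul_comp, LinearMap.comp_smul, hf]

theorem mem_intertwiners {X Y : UnitaryCorep A} {f : X.space →ₗ[ℂ] Y.space} :
    f ∈ intertwiners X Y ↔ LinearMap.rTensor A f ∘ₗ X.coaction = Y.coaction ∘ₗ f := Iff.rfl

theorem mem_intertwiners_iff {X Y : UnitaryCorep A} {f : X.space →ₗ[ℂ] Y.space} :
    f ∈ intertwiners X Y ↔ ∀ v w,
      coeff X.coaction (LinearMap.adjoint f w) v = coeff Y.coaction w (f v) := by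
  rw [mem_intertwiners]
  constructor
  · intro h v w
    rw [coeff, ← contract_rTensor, coeff]
    exact congrArg (contract A w) (LinearMap.congr_fun h v)
  · intro h
    refine LinearMap.ext fun v => contract_ext (stdOrthonormalBasis ℂ Y.space) fun i => ?_
    rw [LinearMap.comp_apply, contract_rTensor]
    exact h v _

theorem adjoint_mem {X Y : UnitaryCorep A} {f : X.space →ₗ[ℂ] Y.space}
    (hf : f ∈ intertwiners X Y) : LinearMap.adjoint f ∈ intertwiners Y X := by
  rw [mem_intertwiners_iff] at hf ⊢
  intro v w
  apply star_injective
  rw [LinearMap.adjoint_adjoint, ← antipode_coeff, ← antipode_coeff, hf]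

theorem symm_mem {X Y : UnitaryCorep A} (e : X.space ≃ₗ[ℂ] Y.space)
    (he : e.toLinearMap ∈ intertwiners X Y) : e.symm.toLinearMap ∈ intertwiners Y X := by
  rw [mem_intertwiners] at he ⊢
  ext v
  obtain ⟨x, rfl⟩ := e.surjective v
  have h := LinearMap.congr_fun he x
  simp only [LinearMap.comp_apply, LinearEquiv.coe_coe] at h ⊢
  rw [← h, ← LinearMap.comp_apply, ← LinearMap.rTensor_comp, e.symm_apply_apply]
  simp

/-- Morphisms are intertwiners. -/
noncomputable instance : Category (UnitaryCorep A) where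
  Hom X Y := intertwiners X Y
  id X := ⟨LinearMap.id, by rw [mem_intertwiners, LinearMap.rTensor_id]; rfl⟩
  comp {X Y Z} f g := ⟨g.1 ∘ₗ f.1, by
    have hf := mem_intertwiners.1 f.2
    have hg := mem_intertwiners.1 g.2
    rw [mem_intertwiners, LinearMap.rTensor_comp, LinearMap.comp_assoc, hf,
      ← LinearMap.comp_assoc, hg, LinearMap.comp_assoc]⟩

/-- The underlying linear map of an intertwiner, as a morphism of Hilbert spaces. -/
noncomputable def toLin {X Y : UnitaryCorep A} (f : X ⟶ Y) : X.space ⟶ Y.space :=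
  Subtype.val (p := (· ∈ intertwiners X Y)) f

/-- An intertwiner from its underlying linear map. -/
noncomputable def ofLin {X Y : UnitaryCorep A} (f : X.space →ₗ[ℂ] Y.space)
    (hf : f ∈ intertwiners X Y) : X ⟶ Y :=
  Subtype.mk (p := (· ∈ intertwiners X Y)) f hf

theorem toLin_mem {X Y : UnitaryCorep A} (f : X ⟶ Y) : toLin f ∈ intertwiners X Y :=
  Subtype.property (p := (· ∈ intertwiners X Y)) f

theorem hom_ext {X Y : UnitaryCorep A} {f g : X ⟶ Y} (h : toLin f = toLin g) : f = g :=
  Subtype.ext (p := (· ∈ intertwiners X Y)) h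

noncomputable instance : Preadditive (UnitaryCorep A) where
  homGroup X Y := inferInstanceAs (AddCommGroup (intertwiners X Y))
  add_comp _ _ _ f f' g := hom_ext
    (Preadditive.add_comp _ _ _ (toLin f) (toLin f') (toLin g))
  comp_add _ _ _ f g g' := hom_ext
    (Preadditive.comp_add _ _ _ (toLin f) (toLin g) (toLin g'))

noncomputable instance : Linear ℂ (UnitaryCorep A) where
  homModule X Y := inferInstanceAs (Module ℂ (intertwiners X Y))
  smul_comp _ _ _ r f g := hom_ext (Linear.smul_comp _ _ _ r (toLin f) (toLin g))
  comp_smul _ _ _ f r g := hom_ext (Linear.comp_smul _ _ _ (toLin f) r (toLin g))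

/-- An invertible intertwiner is an isomorphism. -/
noncomputable def isoOfEquiv {X Y : UnitaryCorep A} (e : X.space ≃ₗ[ℂ] Y.space)
    (he : e.toLinearMap ∈ intertwiners X Y) : X ≅ Y where
  hom := ofLin e.toLinearMap he
  inv := ofLin e.symm.toLinearMap (symm_mem e he)
  hom_inv_id := hom_ext (FdHilb.isoOfEquiv e).hom_inv_id
  inv_hom_id := hom_ext (FdHilb.isoOfEquiv e).inv_hom_id

/-- The trivial representation on `ℂ`. -/
noncomputable def trivial : UnitaryCorep A :=
  ofBasis ⟨ℂ⟩ ((TensorProduct.mk ℂ ℂ A).flip 1) (OrthonormalBasis.singleton Unit ℂ)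
    (by simp [coeff, Algebra.TensorProduct.one_def]) (by simp [coeff]) (by simp [coeff])

/-- The tensor product of two representations. -/
noncomputable def tensor (X Y : UnitaryCorep A) : UnitaryCorep A :=
  ofBasis ⟨X.space ⊗[ℂ] Y.space⟩ (tensorCoaction X.coaction Y.coaction)
    ((stdOrthonormalBasis ℂ X.space).tensorProduct (stdOrthonormalBasis ℂ Y.space))
    (by
      rintro ⟨i, j⟩ ⟨k, l⟩
      simp only [OrthonormalBasis.tensorProduct_apply, coeff_tensor, Bialgebra.comul_mul,
        (isCoassociative_iff _ _).1 X.coassoc, (isCoassociative_iff _ _).1 Y.coassoc,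
        Finset.sum_mul_sum, Algebra.TensorProduct.tmul_mul_tmul, Fintype.sum_prod_type])
    (by
      rintro ⟨i, j⟩ ⟨k, l⟩
      simp only [OrthonormalBasis.tensorProduct_apply, coeff_tensor, Bialgebra.counit_mul,
        (isCounital_iff _ _).1 X.counit, (isCounital_iff _ _).1 Y.counit, Prod.mk.injEq]
      split_ifs <;> simp_all)
    (by
      rintro ⟨i, j⟩ ⟨k, l⟩
      simp only [OrthonormalBasis.tensorProduct_apply, coeff_tensor,
        HopfAlgebra.antipode_mul_antidistrib, antipode_coeff, star_mul])

theorem map_mem {X X' Y Y' : UnitaryCorep A} {f : X.space →ₗ[ℂ] X'.space}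
    {g : Y.space →ₗ[ℂ] Y'.space} (hf : f ∈ intertwiners X X') (hg : g ∈ intertwiners Y Y') :
    TensorProduct.map f g ∈ intertwiners (tensor X Y) (tensor X' Y') := by
  rw [mem_intertwiners] at hf hg
  refine mem_intertwiners.2 (TensorProduct.ext' fun x y => ?_)
  have h : LinearMap.rTensor A (TensorProduct.map f g)
      (tensorCoaction X.coaction Y.coaction (x ⊗ₜ y)) =
      tensorCoaction X'.coaction Y'.coaction (f x ⊗ₜ g y) := by
    rw [tensorCoaction_tmul, merge_map, tensorCoaction_tmul]
    congr 2
    exacts [LinearMap.congr_fun hf x, LinearMap.congr_fun hg y]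
  exact h

theorem id_mem (X : UnitaryCorep A) : LinearMap.id ∈ intertwiners X X := toLin_mem (𝟙 X)

theorem assoc_mem (X Y Z : UnitaryCorep A) :
    (TensorProduct.assoc ℂ X.space Y.space Z.space).toLinearMap ∈
      intertwiners (tensor (tensor X Y) Z) (tensor X (tensor Y Z)) := by
  refine mem_intertwiners.2 (TensorProduct.ext_threefold fun x y z => ?_)
  have h : LinearMap.rTensor A (TensorProduct.assoc ℂ X.space Y.space Z.space).toLinearMap
      (tensorCoaction (tensorCoaction X.coaction Y.coaction) Z.coaction ((x ⊗ₜ y) ⊗ₜ z)) =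
      tensorCoaction X.coaction (tensorCoaction Y.coaction Z.coaction) (x ⊗ₜ (y ⊗ₜ z)) := by
    simp only [tensorCoaction_tmul]
    exact merge_assoc _ _ _
  exact h

theorem lid_mem (X : UnitaryCorep A) :
    (TensorProduct.lid ℂ X.space).toLinearMap ∈ intertwiners (tensor trivial X) X := by
  refine mem_intertwiners.2 (TensorProduct.ext' fun (z : ℂ) (x : X.space) => ?_)
  have h : LinearMap.rTensor A (TensorProduct.lid ℂ X.space).toLinearMap
      (tensorCoaction ((TensorProduct.mk ℂ ℂ A).flip 1) X.coaction (z ⊗ₜ x)) =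
      X.coaction (z • x) := by
    rw [tensorCoaction_tmul, map_smul]
    exact merge_lid z _
  exact h

theorem rid_mem (X : UnitaryCorep A) :
    (TensorProduct.rid ℂ X.space).toLinearMap ∈ intertwiners (tensor X trivial) X := by
  refine mem_intertwiners.2 (TensorProduct.ext' fun (x : X.space) (z : ℂ) => ?_)
  have h : LinearMap.rTensor A (TensorProduct.rid ℂ X.space).toLinearMap
      (tensorCoaction X.coaction ((TensorProduct.mk ℂ ℂ A).flip 1) (x ⊗ₜ z)) =
      X.coaction (z • x) := by
    rw [tensorCoaction_tmul, map_smul]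
    exact merge_rid z _
  exact h

noncomputable instance : MonoidalCategoryStruct (UnitaryCorep A) where
  tensorObj := tensor
  whiskerLeft X _ _ f := ofLin (TensorProduct.map LinearMap.id (toLin f))
    (map_mem (id_mem X) (toLin_mem f))
  whiskerRight f Y := ofLin (TensorProduct.map (toLin f) LinearMap.id)
    (map_mem (toLin_mem f) (id_mem Y))
  tensorHom f g := ofLin (TensorProduct.map (toLin f) (toLin g))
    (map_mem (toLin_mem f) (toLin_mem g))
  tensorUnit := trivial
  associator X Y Z := isoOfEquiv (TensorProduct.assoc ℂ X.space Y.space Z.space) (assoc_mem X Y Z)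
  leftUnitor X := isoOfEquiv (TensorProduct.lid ℂ X.space) (lid_mem X)
  rightUnitor X := isoOfEquiv (TensorProduct.rid ℂ X.space) (rid_mem X)

/-- The monoidal structure is the one of the underlying Hilbert spaces. -/
noncomputable instance : MonoidalCategory (UnitaryCorep A) :=
  MonoidalCategory.ofTensorHom
    (id_tensorHom_id := fun X Y => hom_ext (id_tensorHom_id X.space Y.space))
    (id_tensorHom := fun _ _ _ _ => rfl)
    (tensorHom_id := fun _ _ => rfl)
    (tensorHom_comp_tensorHom := fun f₁ f₂ g₁ g₂ =>
      hom_ext (tensorHom_comp_tensorHom (toLin f₁) (toLin f₂) (toLin g₁) (toLin g₂)))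
    (associator_naturality := fun f₁ f₂ f₃ =>
      hom_ext (associator_naturality (toLin f₁) (toLin f₂) (toLin f₃)))
    (leftUnitor_naturality := fun f => hom_ext
      ((congrArg (· ≫ _) (id_tensorHom _ (toLin f))).trans (leftUnitor_naturality (toLin f))))
    (rightUnitor_naturality := fun f => hom_ext
      ((congrArg (· ≫ _) (tensorHom_id (toLin f) _)).trans (rightUnitor_naturality (toLin f))))
    (pentagon := fun W X Y Z => hom_ext (pentagon W.space X.space Y.space Z.space))
    (triangle := fun X Y => hom_ext (triangle X.space Y.space))

/-- The dagger of an intertwiner is its adjoint. -/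
noncomputable instance : DaggerMonoidalCategory (UnitaryCorep A) where
  dagger f := ofLin (LinearMap.adjoint (toLin f)) (adjoint_mem (toLin_mem f))
  dagger_id X := hom_ext (DaggerMonoidalCategory.dagger_id X.space)
  dagger_comp f g := hom_ext (DaggerMonoidalCategory.dagger_comp (toLin f) (toLin g))
  dagger_dagger f := hom_ext (DaggerMonoidalCategory.dagger_dagger (toLin f))
  dagger_tensor f g := hom_ext (DaggerMonoidalCategory.dagger_tensor (toLin f) (toLin g))
  dagger_associator X Y Z := hom_ext
    (DaggerMonoidalCategory.dagger_associator X.space Y.space Z.space)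
  dagger_leftUnitor X := hom_ext (DaggerMonoidalCategory.dagger_leftUnitor X.space)
  dagger_rightUnitor X := hom_ext (DaggerMonoidalCategory.dagger_rightUnitor X.space)

end UnitaryCorep

end

/-! ### Fibre functors and `Fun(Rep(G), Hilb)` -/

section

open MonoidalCategory DaggerMonoidalCategory
open scoped TensorProduct

/-- A compact quantum group `G`, given by its compact quantum group algebra: a Hopf `*`-algebra
over `ℂ` which is spanned by the matrix coefficients of its finite-dimensional unitary
corepresentations. -/
structure CompactQuantumGroup where
  /-- The compact quantum group algebra. -/
  algebra : Type u
  [ring : Ring algebra]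
  [starRing : StarRing algebra]
  [hopfAlgebra : HopfAlgebra ℂ algebra]
  [starModule : StarModule ℂ algebra]
  comul_star (a : algebra) :
    Coalgebra.comul (R := ℂ) (star a) = star (Coalgebra.comul (R := ℂ) a)
  span_coeff : Submodule.span ℂ {a : algebra | ∃ (X : UnitaryCorep algebra) (v w : X.space),
    Corep.coeff X.coaction v w = a} = ⊤

attribute [instance] CompactQuantumGroup.ring CompactQuantumGroup.starRing
  CompactQuantumGroup.hopfAlgebra CompactQuantumGroup.starModule

/-- The category of (finite-dimensional, continuous) unitary representations of a compact quantum
group. -/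
abbrev RepCQG (G : CompactQuantumGroup.{u}) := UnitaryCorep G.algebra

/-- A fibre functor: a `ℂ`-linear unitary monoidal functor `Rep(G) ⥤ Hilb`. -/
structure FibreFunctor (G : CompactQuantumGroup.{u}) where
  /-- The underlying functor. -/
  functor : RepCQG G ⥤ FdHilb
  [monoidal : functor.Monoidal]
  [additive : functor.Additive]
  [linear : functor.Linear ℂ]
  map_dagger {X Y : RepCQG G} (f : X ⟶ Y) : functor.map (dagger f) = dagger (functor.map f)
  unit_unitary : IsUnitaryHom (Functor.LaxMonoidal.ε functor)
  tensor_unitary (X Y : RepCQG G) : IsUnitaryHom (Functor.LaxMonoidal.μ functor X Y)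

namespace FibreFunctor

attribute [instance] monoidal additive linear

variable {G : CompactQuantumGroup.{u}}

/-- The pseudofunctor between one-object 2-categories given by a monoidal functor. -/
noncomputable def toPseudofunctor (F : FibreFunctor G) :
    Pseudofunctor (MonoidalSingleObj (RepCQG G)) (MonoidalSingleObj FdHilb) where
  obj _ := MonoidalSingleObj.star FdHilb
  map X := F.functor.obj X
  map₂ f := F.functor.map f
  map₂_id X := F.functor.map_id X
  map₂_comp f g := F.functor.map_comp f g
  mapId _ := (Functor.Monoidal.εIso F.functor).symm
  mapComp X Y := (Functor.Monoidal.μIso F.functor X Y).symm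
  map₂_whisker_left X _ _ f := Functor.Monoidal.map_whiskerLeft F.functor X f
  map₂_whisker_right f Z := Functor.Monoidal.map_whiskerRight F.functor f Z
  map₂_associator X Y Z := Functor.Monoidal.map_associator F.functor X Y Z
  map₂_left_unitor X := Functor.Monoidal.map_leftUnitor F.functor X
  map₂_right_unitor X := Functor.Monoidal.map_rightUnitor F.functor X

/-- A fibre functor as a unitary pseudofunctor between one-object dagger 2-categories. -/
noncomputable def toUnitaryPseudofunctor (F : FibreFunctor G) :
    UnitaryPseudofunctor (MonoidalSingleObj (RepCQG G)) (MonoidalSingleObj FdHilb) where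
  toPseudofunctor := F.toPseudofunctor
  map₂_dagger f := F.map_dagger f
  mapId_unitary _ := DaggerBicategory.IsUnitary.inv (B := MonoidalSingleObj FdHilb)
    (a := MonoidalSingleObj.star FdHilb) (b := MonoidalSingleObj.star FdHilb)
    (e := Functor.Monoidal.εIso F.functor) F.unit_unitary
  mapComp_unitary X Y := DaggerBicategory.IsUnitary.inv (B := MonoidalSingleObj FdHilb)
    (a := MonoidalSingleObj.star FdHilb) (b := MonoidalSingleObj.star FdHilb)
    (e := Functor.Monoidal.μIso F.functor X Y) (F.tensor_unitary X Y)

/-- Two fibre functors are unitarily monoidally naturally isomorphic if there is a monoidal natural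
isomorphism between them with unitary components. -/
def UnitarilyMonoidallyIsomorphic (F₁ F₂ : FibreFunctor G) : Prop :=
  ∃ e : F₁.functor ≅ F₂.functor, NatTrans.IsMonoidal e.hom ∧
    ∀ X : RepCQG G, IsUnitaryHom (e.hom.app X)

end FibreFunctor

/-- The dagger 2-category `Fun(Rep(G), Hilb)`: objects are fibre functors, 1-morphisms are unitary
pseudonatural transformations and 2-morphisms are modifications. -/
abbrev FunRepHilb (G : CompactQuantumGroup.{u}) :=
  Bicategory.InducedBicategory
    (UnitaryPseudofunctor (MonoidalSingleObj (RepCQG G)) (MonoidalSingleObj FdHilb))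
    (FibreFunctor.toUnitaryPseudofunctor (G := G))

end

/-! A 1-morphism `F₁ ⟶ F₂` is a Hilbert space `H` with unitaries `F₁ V ⊗ H ≅ H ⊗ F₂ V`. When `H` is
the unit `ℂ`, the unitors turn these into unitaries `F₁ V ≅ F₂ V`, and the axioms of a pseudonatural
transformation become naturality and monoidality. The theorem therefore amounts to showing that the
space of a dagger equivalence is one-dimensional.

If `K` is the space of a weak inverse, the unit 2-morphism is in particular a linear isomorphism `ℂ
≅ K ⊗ H`. Hence `dim K * dim H = 1` and `dim H = 1` (`finrank_eq_one_of_iso`). A unit vector of `H`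
gives a unitary `u : ℂ ≅ H` (`exists_unitary_unit`), and conjugation by `u` (`unitConj`) yields the
required isomorphism. Its monoidality rests on `unitConj_unitors` and `unitConj_tensor`, and
`isUnitaryHom_unitConj` gives unitarity.

Conversely, a unitary monoidal isomorphism `e` defines a 1-morphism with space `ℂ` and components `ρ
≫ e ≫ λ⁻¹` (`ofIso`), and `e⁻¹` defines its weak inverse. The unit 2-morphism is `ℂ ≅ ℂ ⊗ ℂ`; it is
a modification because `e` and `e⁻¹` cancel (`toUnit_comp`). -/

section

open MonoidalCategory

/-! ### Conjugation by an isomorphism from the tensor unit, in any monoidal category. -/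

section Conj

variable {D : Type u₁} [Category.{v₁} D] [MonoidalCategory D] {H : D}

/-- Conjugating a morphism `V ⊗ H ⟶ H ⊗ W` by an isomorphism `𝟙_ D ≅ H`. -/
def unitConj {V W : D} (u : 𝟙_ D ≅ H) (a : V ⊗ H ⟶ H ⊗ W) : V ⟶ W :=
  (ρ_ V).inv ≫ V ◁ u.hom ≫ a ≫ u.inv ▷ W ≫ (λ_ W).hom

/-- `unitConj` for isomorphisms. -/
@[simps]
def unitConjIso {V W : D} (u : 𝟙_ D ≅ H) (a : V ⊗ H ≅ H ⊗ W) : V ≅ W where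
  hom := unitConj u a.hom
  inv := (λ_ W).inv ≫ u.hom ▷ W ≫ a.inv ≫ V ◁ u.inv ≫ (ρ_ V).hom
  hom_inv_id := by
    simp [unitConj, ← comp_whiskerRight_assoc, ← MonoidalCategory.whiskerLeft_comp_assoc,
      -MonoidalCategory.whiskerLeft_comp, -comp_whiskerRight]
  inv_hom_id := by
    simp [unitConj, ← comp_whiskerRight_assoc, ← MonoidalCategory.whiskerLeft_comp_assoc,
      -MonoidalCategory.whiskerLeft_comp, -comp_whiskerRight]

/-- Everything around `a` in `unitConj u a` is invertible and can be moved to the other side. The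
resulting equation contains `u` but not its inverse, so the later identities are proved by sliding a
single `u` from right to left. -/
theorem unitConj_eq_iff {V W : D} (u : 𝟙_ D ≅ H) (a : V ⊗ H ⟶ H ⊗ W) (e : V ⟶ W) :
    unitConj u a = e ↔ V ◁ u.hom ≫ a = (ρ_ V).hom ≫ e ≫ (λ_ W).inv ≫ u.hom ▷ W := by
  constructor
  · rintro rfl
    simp [unitConj, ← comp_whiskerRight]
  · intro h
    rw [unitConj, reassoc_of% h]
    simp [← comp_whiskerRight_assoc, -comp_whiskerRight]

theorem whiskerLeft_comp_eq_unitConj {V W : D} (u : 𝟙_ D ≅ H) (a : V ⊗ H ⟶ H ⊗ W) :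
    V ◁ u.hom ≫ a = (ρ_ V).hom ≫ unitConj u a ≫ (λ_ W).inv ≫ u.hom ▷ W :=
  (unitConj_eq_iff u a _).1 rfl

theorem unitConj_comp_left {V V' W : D} (u : 𝟙_ D ≅ H) (f : V' ⟶ V) (a : V ⊗ H ⟶ H ⊗ W) :
    unitConj u (f ▷ H ≫ a) = f ≫ unitConj u a := by
  rw [unitConj_eq_iff, whisker_exchange_assoc, whiskerLeft_comp_eq_unitConj]
  simp

theorem unitConj_comp_right {V W W' : D} (u : 𝟙_ D ≅ H) (a : V ⊗ H ⟶ H ⊗ W) (g : W ⟶ W') :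
    unitConj u (a ≫ H ◁ g) = unitConj u a ≫ g := by
  rw [unitConj_eq_iff, ← Category.assoc, whiskerLeft_comp_eq_unitConj]
  simp [← whisker_exchange]

/-- By naturality of the unitors `u` passes through, leaving `λ = ρ` at the unit object. This is the
component that a pseudonatural transformation has at the unit, up to the unit constraints of the two
functors. -/
theorem unitConj_unitors (u : 𝟙_ D ≅ H) :
    unitConj u ((λ_ H).hom ≫ (ρ_ H).inv) = 𝟙 (𝟙_ D) := by
  rw [unitConj_eq_iff]
  simp [unitors_equal, unitors_inv_equal]

/-- The composite on the left is the one in the tensor axiom `component_tensor`. One copy of `u`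
enters at the right, crosses `b`, reappears in the middle, and then crosses `a`; each crossing
leaves a conjugated morphism behind. -/
theorem unitConj_tensor {V W V' W' : D} (u : 𝟙_ D ≅ H) (a : V ⊗ H ⟶ H ⊗ W)
    (b : V' ⊗ H ⟶ H ⊗ W') :
    unitConj u ((α_ V V' H).hom ≫ V ◁ b ≫ (α_ V H W').inv ≫ a ▷ W' ≫ (α_ H W W').hom) =
      unitConj u a ⊗ₘ unitConj u b := by
  have ha := whiskerLeft_comp_eq_unitConj u a
  have hb := whiskerLeft_comp_eq_unitConj u b
  have hb' := congrArg (V ◁ ·) hb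
  have ha' := congrArg (· ▷ W') ha
  simp only [MonoidalCategory.whiskerLeft_comp, comp_whiskerRight] at ha' hb'
  rw [unitConj_eq_iff, associator_naturality_right_assoc, reassoc_of% hb',
    associator_inv_naturality_middle_assoc, reassoc_of% ha', tensorHom_def']
  -- Both sides now apply `f`, then `e`, then `u`, and differ only by structural isomorphisms.
  generalize unitConj u a = e
  generalize unitConj u b = f
  monoidal

end Conj

end

section

open MonoidalCategory

/-! ### The converse dictionary: axioms for components of the form `ρ ≫ e ≫ λ⁻¹`. -/

section ToUnit

variable {D : Type u₁} [Category.{v₁} D] [MonoidalCategory D]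

theorem toUnit_natural {V W V' W' : D} {f : V ⟶ V'} {g : W ⟶ W'} {e : V ⟶ W} {e' : V' ⟶ W'}
    (h : f ≫ e' = e ≫ g) :
    f ▷ 𝟙_ D ≫ (ρ_ V').hom ≫ e' ≫ (λ_ W').inv =
      ((ρ_ V).hom ≫ e ≫ (λ_ W).inv) ≫ 𝟙_ D ◁ g := by
  simp [reassoc_of% h]

theorem toUnit_unit {V W : D} {e : V ⟶ W} {f : V ⟶ 𝟙_ D} {g : W ⟶ 𝟙_ D} (h : e ≫ g = f) :
    ((ρ_ V).hom ≫ e ≫ (λ_ W).inv) ≫ 𝟙_ D ◁ g =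
      f ▷ 𝟙_ D ≫ (λ_ (𝟙_ D)).hom ≫ (ρ_ (𝟙_ D)).inv := by
  subst h
  simp [unitors_equal, unitors_inv_equal]

/-- Here `f` and `g` stand for the constraints `δ` of the two functors and `t` for the component at
the tensor product. The hypothesis is monoidality in oplax form, since `mapComp` of the
pseudofunctor is the inverse of `μ`. -/
theorem toUnit_tensor {V W V' W' T S : D} {e : V ⟶ W} {e' : V' ⟶ W'} {t : T ⟶ S}
    {f : T ⟶ V ⊗ V'} {g : S ⟶ W ⊗ W'} (h : t ≫ g = f ≫ (e ⊗ₘ e')) :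
    ((ρ_ T).hom ≫ t ≫ (λ_ S).inv) ≫ 𝟙_ D ◁ g =
      f ▷ 𝟙_ D ≫ (α_ V V' (𝟙_ D)).hom ≫ V ◁ ((ρ_ V').hom ≫ e' ≫ (λ_ W').inv) ≫
        (α_ V (𝟙_ D) W').inv ≫ ((ρ_ V).hom ≫ e ≫ (λ_ W).inv) ▷ W' ≫ (α_ (𝟙_ D) W W').hom := by
  -- Bring `t` and `g` together so that `h` applies.
  have h' : ((ρ_ T).hom ≫ t ≫ (λ_ S).inv) ≫ 𝟙_ D ◁ g =
      (ρ_ T).hom ≫ (t ≫ g) ≫ (λ_ _).inv := by simp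
  rw [h', h, tensorHom_def', Category.assoc, ← rightUnitor_naturality_assoc f]
  monoidal

/-- This is the modification equation for `ℂ ≅ ℂ ⊗ ℂ`, from the identity to the composite of the
1-morphisms given by `e` and `f`. Coherence reduces the left side to `e ≫ f`. -/
theorem toUnit_comp {V W : D} {e : V ⟶ W} {f : W ⟶ V} (h : e ≫ f = 𝟙 V) :
    V ◁ (λ_ (𝟙_ D)).inv ≫ (α_ V (𝟙_ D) (𝟙_ D)).inv ≫ ((ρ_ V).hom ≫ e ≫ (λ_ W).inv) ▷ 𝟙_ D ≫
        (α_ (𝟙_ D) W (𝟙_ D)).hom ≫ 𝟙_ D ◁ ((ρ_ W).hom ≫ f ≫ (λ_ V).inv) ≫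
          (α_ (𝟙_ D) (𝟙_ D) V).inv =
      ((ρ_ V).hom ≫ (λ_ V).inv) ≫ (λ_ (𝟙_ D)).inv ▷ V := by
  trans (ρ_ V).hom ≫ (e ≫ f) ≫ (λ_ V).inv ≫ (λ_ (𝟙_ D)).inv ▷ V
  · monoidal
  · simp [h]

end ToUnit

/-! ### Closure properties of unitary morphisms. -/

namespace DaggerMonoidalCategory

variable {D : Type u₁} [Category.{v₁} D] [MonoidalCategory D] [DaggerMonoidalCategory D]

/-- Unitarity in `D` is by definition unitarity of 2-morphisms in the one-object 2-category
`MonoidalSingleObj D`, so this fact and the next ones are inherited from there. -/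
theorem IsUnitaryHom.comp {X Y Z : D} {f : X ⟶ Y} {g : Y ⟶ Z} (hf : IsUnitaryHom f)
    (hg : IsUnitaryHom g) : IsUnitaryHom (f ≫ g) :=
  DaggerBicategory.IsUnitary.comp (B := MonoidalSingleObj D) (a := MonoidalSingleObj.star D)
    (b := MonoidalSingleObj.star D) hf hg

theorem IsUnitaryHom.inv {X Y : D} {e : X ≅ Y} (h : IsUnitaryHom e.hom) : IsUnitaryHom e.inv :=
  DaggerBicategory.IsUnitary.inv (B := MonoidalSingleObj D) (a := MonoidalSingleObj.star D)
    (b := MonoidalSingleObj.star D) (e := e) h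

theorem IsUnitaryHom.whiskerLeft (V : D) {X Y : D} {f : X ⟶ Y} (hf : IsUnitaryHom f) :
    IsUnitaryHom (V ◁ f) :=
  DaggerBicategory.IsUnitary.whiskerLeft (B := MonoidalSingleObj D)
    (a := MonoidalSingleObj.star D) (b := MonoidalSingleObj.star D)
    (c := MonoidalSingleObj.star D) V hf

theorem IsUnitaryHom.whiskerRight {X Y : D} {f : X ⟶ Y} (hf : IsUnitaryHom f) (V : D) :
    IsUnitaryHom (f ▷ V) :=
  DaggerBicategory.IsUnitary.whiskerRight (B := MonoidalSingleObj D)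
    (a := MonoidalSingleObj.star D) (b := MonoidalSingleObj.star D)
    (c := MonoidalSingleObj.star D) hf V

theorem isUnitaryHom_leftUnitor (V : D) : IsUnitaryHom (λ_ V).hom :=
  DaggerBicategory.isUnitary_leftUnitor (B := MonoidalSingleObj D)
    (a := MonoidalSingleObj.star D) (b := MonoidalSingleObj.star D) V

theorem isUnitaryHom_rightUnitor (V : D) : IsUnitaryHom (ρ_ V).hom :=
  DaggerBicategory.isUnitary_rightUnitor (B := MonoidalSingleObj D)
    (a := MonoidalSingleObj.star D) (b := MonoidalSingleObj.star D) V

theorem isUnitaryHom_unitConj {H V W : D} {u : 𝟙_ D ≅ H} (hu : IsUnitaryHom u.hom)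
    {a : V ⊗ H ⟶ H ⊗ W} (ha : IsUnitaryHom a) : IsUnitaryHom (unitConj u a) :=
  (isUnitaryHom_rightUnitor V).inv.comp <| (hu.whiskerLeft V).comp <| ha.comp <|
    (hu.inv.whiskerRight W).comp (isUnitaryHom_leftUnitor W)

end DaggerMonoidalCategory

open DaggerMonoidalCategory

/-! ### One-dimensional Hilbert spaces. -/

namespace FdHilb

/-- A one-dimensional Hilbert space is unitarily isomorphic to the unit. -/
theorem exists_unitary_unit {H : FdHilb} (h : Module.finrank ℂ H = 1) :
    ∃ u : 𝟙_ FdHilb ≅ H, IsUnitaryHom u.hom := by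
  let b : OrthonormalBasis Unit ℂ H :=
    (stdOrthonormalBasis ℂ H).reindex ((finCongr h).trans finOneEquiv)
  -- Send `1` to the unit vector that forms the basis `b`; matching orthonormal bases makes the map
  -- isometric.
  let e : ℂ ≃ₗᵢ[ℂ] H := (OrthonormalBasis.singleton Unit ℂ).equiv b (Equiv.refl _)
  refine ⟨isoOfEquiv (V := ⟨ℂ⟩) (W := H) e.toLinearEquiv, ?_⟩
  exact DaggerBicategory.isUnitary_of_iso (B := MonoidalSingleObj FdHilb)
    (a := MonoidalSingleObj.star FdHilb) (b := MonoidalSingleObj.star FdHilb)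
    (isoOfEquiv (V := ⟨ℂ⟩) (W := H) e.toLinearEquiv)
    (adjoint_isometryEquiv (V := ⟨ℂ⟩) (W := H) e)

/-- If `K ⊗ H` is isomorphic to the unit, then `H` is one-dimensional. -/
theorem finrank_eq_one_of_iso {K H : FdHilb} (e : 𝟙_ FdHilb ≅ K ⊗ H) :
    Module.finrank ℂ H = 1 := by
  let l : ℂ ≃ₗ[ℂ] TensorProduct ℂ K H :=
    LinearEquiv.ofLinearMap (M := ℂ) (M₂ := TensorProduct ℂ K H) e.hom e.inv
      e.inv_hom_id e.hom_inv_id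
  have h := l.finrank_eq
  rw [Module.finrank_self, Module.finrank_tensorProduct] at h
  exact Nat.eq_one_of_mul_eq_one_left h.symm

end FdHilb

/-! ### From 1-morphisms with one-dimensional space to unitary monoidal isomorphisms. -/

namespace FibreFunctor

variable {G : CompactQuantumGroup.{u}} {F₁ F₂ : FibreFunctor G}

open Functor.LaxMonoidal Functor.OplaxMonoidal

/-- The 1-morphisms `F₁ ⟶ F₂` of `Fun(Rep(G), Hilb)`. -/
abbrev Trans (F₁ F₂ : FibreFunctor G) :=
  UnitaryPseudofunctor.UPT F₁.toUnitaryPseudofunctor F₂.toUnitaryPseudofunctor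

namespace Trans

/-- The Hilbert space underlying a 1-morphism of `Fun(Rep(G), Hilb)`. -/
noncomputable def space (X : Trans F₁ F₂) : FdHilb :=
  X.trans.app (MonoidalSingleObj.star _)

/-- The components of a 1-morphism of `Fun(Rep(G), Hilb)`. -/
noncomputable def component (X : Trans F₁ F₂) (V : RepCQG G) :
    F₁.functor.obj V ⊗ X.space ≅ X.space ⊗ F₂.functor.obj V :=
  X.trans.naturality (a := MonoidalSingleObj.star _) (b := MonoidalSingleObj.star _) V

variable (X : Trans F₁ F₂)

/-- This and the next two lemmas are the pseudonaturality axioms, unfolded definitionally into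
monoidal notation; `η` and `δ` appear because `mapId` and `mapComp` invert `ε` and `μ`. -/
theorem component_natural {V W : RepCQG G} (f : V ⟶ W) :
    F₁.functor.map f ▷ X.space ≫ (X.component W).hom =
      (X.component V).hom ≫ X.space ◁ F₂.functor.map f :=
  X.trans.naturality_naturality (a := MonoidalSingleObj.star _) (b := MonoidalSingleObj.star _) f

theorem component_unit :
    (X.component (𝟙_ _)).hom ≫ X.space ◁ η F₂.functor =
      η F₁.functor ▷ X.space ≫ (λ_ X.space).hom ≫ (ρ_ X.space).inv :=
  X.trans.naturality_id (MonoidalSingleObj.star _)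

theorem component_tensor (V W : RepCQG G) :
    (X.component (V ⊗ W)).hom ≫ X.space ◁ δ F₂.functor V W =
      δ F₁.functor V W ▷ X.space ≫ (α_ _ _ _).hom ≫
        F₁.functor.obj V ◁ (X.component W).hom ≫ (α_ _ _ _).inv ≫
          (X.component V).hom ▷ F₂.functor.obj W ≫ (α_ _ _ _).hom :=
  X.trans.naturality_comp (a := MonoidalSingleObj.star _) (b := MonoidalSingleObj.star _)
    (c := MonoidalSingleObj.star _) V W

/-- A 1-morphism whose Hilbert space is the unit up to unitary isomorphism gives a unitary
monoidal natural isomorphism. -/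
theorem unitarilyMonoidallyIsomorphic {u : 𝟙_ FdHilb ≅ X.space} (hu : IsUnitaryHom u.hom) :
    UnitarilyMonoidallyIsomorphic F₁ F₂ := by
  refine ⟨NatIso.ofComponents (fun V => unitConjIso u (X.component V)) fun {V W} f => ?_,
    ⟨?_, fun V W => ?_⟩, fun V => ?_⟩
  · simp only [unitConjIso_hom]
    rw [← unitConj_comp_left, X.component_natural, unitConj_comp_right]
  -- Solve the unit axiom for the component, using that `ε` inverts `η`; the outer factors then
  -- leave `unitConj` on both sides. The tensor case below does the same with `μ` and `δ`.
  · have h : (X.component (𝟙_ _)).hom =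
        η F₁.functor ▷ X.space ≫ ((λ_ X.space).hom ≫ (ρ_ X.space).inv) ≫
          X.space ◁ ε F₂.functor := by
      rw [← cancel_mono (X.space ◁ η F₂.functor), X.component_unit]
      simp [← MonoidalCategory.whiskerLeft_comp]
    simp only [NatIso.ofComponents_hom_app, unitConjIso_hom]
    rw [h, unitConj_comp_left, unitConj_comp_right, unitConj_unitors]
    simp
  · have h : (X.component (V ⊗ W)).hom =
        δ F₁.functor V W ▷ X.space ≫ ((α_ _ _ _).hom ≫
        F₁.functor.obj V ◁ (X.component W).hom ≫ (α_ _ _ _).inv ≫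
          (X.component V).hom ▷ F₂.functor.obj W ≫ (α_ _ _ _).hom) ≫
            X.space ◁ μ F₂.functor V W := by
      rw [← cancel_mono (X.space ◁ δ F₂.functor V W), X.component_tensor]
      simp [← MonoidalCategory.whiskerLeft_comp]
    simp only [NatIso.ofComponents_hom_app, unitConjIso_hom]
    rw [h, unitConj_comp_left, unitConj_comp_right, unitConj_tensor]
    simp
  · exact isUnitaryHom_unitConj hu
      (X.unitary (a := MonoidalSingleObj.star _) (b := MonoidalSingleObj.star _) V)

/-! ### From unitary monoidal isomorphisms to dagger equivalences. -/

/-- The 1-morphism with Hilbert space `ℂ` given by a unitary monoidal natural isomorphism. -/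
noncomputable def ofIso (e : F₁.functor ≅ F₂.functor) (he : NatTrans.IsMonoidal e.hom)
    (hu : ∀ V, IsUnitaryHom (e.hom.app V)) : Trans F₁ F₂ where
  trans :=
    { app _ := 𝟙_ FdHilb
      naturality V := ρ_ (F₁.functor.obj V) ≪≫ e.app V ≪≫ (λ_ (F₂.functor.obj V)).symm
      naturality_naturality f := toUnit_natural (e.hom.naturality f)
      naturality_id _ := toUnit_unit (D := FdHilb) <|
        -- Monoidality of `e` is stated with `ε` and `μ`; cancelling these isomorphisms gives the
        -- oplax form needed here and in `naturality_comp`.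
        have h : e.hom.app (𝟙_ _) ≫ η F₂.functor = η F₁.functor := by
          rw [← cancel_epi (ε F₁.functor), reassoc_of% he.unit, Functor.Monoidal.ε_η,
            Functor.Monoidal.ε_η]
        h
      naturality_comp V W := toUnit_tensor (D := FdHilb) <|
        have h (V W : RepCQG G) : e.hom.app (V ⊗ W) ≫ δ F₂.functor V W =
            δ F₁.functor V W ≫ (e.hom.app V ⊗ₘ e.hom.app W) := by
          rw [← cancel_epi (μ F₁.functor V W), Functor.Monoidal.μ_δ_assoc,
            reassoc_of% he.tensor, Functor.Monoidal.μ_δ, Category.comp_id]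
        h V W }
  unitary {_ _} V := (isUnitaryHom_rightUnitor (D := FdHilb) _).comp
    ((hu V).comp (isUnitaryHom_leftUnitor (D := FdHilb) _).inv)

/-- A 1-morphism of unitary pseudofunctors as a 1-morphism of `Fun(Rep(G), Hilb)`. -/
noncomputable abbrev toHom (X : Trans F₁ F₂) : @Quiver.Hom (FunRepHilb G) _ F₁ F₂ :=
  Bicategory.InducedBicategory.mkHom (F := toUnitaryPseudofunctor (G := G)) (X := F₁) (Y := F₂) X

section

-- With `f` independent of `e` and a one-sided `h`, the same construction serves both composites of
-- `e` with its inverse.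
variable {e : F₁.functor ≅ F₂.functor} {f : F₂.functor ≅ F₁.functor}
  (he : NatTrans.IsMonoidal e.hom) (hf : NatTrans.IsMonoidal f.hom)
  (hu : ∀ V, IsUnitaryHom (e.hom.app V)) (hv : ∀ V, IsUnitaryHom (f.hom.app V))
  (h : ∀ V, e.hom.app V ≫ f.hom.app V = 𝟙 _)

open scoped Pseudofunctor.StrongTrans in
/-- The modification from the identity to the composite of the 1-morphisms given by mutually
inverse natural isomorphisms. -/
noncomputable def unitModification : Pseudofunctor.StrongTrans.Modification
    (𝟙 F₁.toUnitaryPseudofunctor.toPseudofunctor)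
    ((ofIso e he hu).trans ≫ (ofIso f hf hv).trans) where
  app _ := (λ_ (𝟙_ FdHilb)).inv
  naturality {_ _} V := by
    rw [Pseudofunctor.StrongTrans.categoryStruct_id_naturality_hom,
      Pseudofunctor.StrongTrans.categoryStruct_comp_naturality_hom]
    exact toUnit_comp (h V)

/-- The 2-morphism from the identity to the composite of the 1-morphisms given by mutually inverse
natural isomorphisms. -/
noncomputable def unitOfIso : Bicategory.InducedBicategory.Hom₂
    (CategoryStruct.id (obj := FunRepHilb G) F₁) ((ofIso e he hu).toHom ≫ (ofIso f hf hv).toHom) :=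
  ⟨⟨⟨unitModification he hf hu hv h⟩⟩⟩

/-- Dagger and composition of modifications are componentwise, so only unitarity of `λ⁻¹` at the
unit object has to be checked. -/
theorem isUnitary_unitOfIso :
    DaggerBicategory.IsUnitary (B := FunRepHilb G) (unitOfIso he hf hu hv h) :=
  ⟨Bicategory.InducedBicategory.hom₂_ext (UnitaryPseudofunctor.hom₂_ext
      (Pseudofunctor.StrongTrans.homCategory.ext fun _ =>
        (isUnitaryHom_leftUnitor (𝟙_ FdHilb)).inv.1)),
    Bicategory.InducedBicategory.hom₂_ext (UnitaryPseudofunctor.hom₂_ext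
      (Pseudofunctor.StrongTrans.homCategory.ext fun _ =>
        (isUnitaryHom_leftUnitor (𝟙_ FdHilb)).inv.2))⟩

end

end Trans

end FibreFunctor

/-! ### The equivalence of the two notions. -/

theorem mainTheorem11 (G : CompactQuantumGroup.{u}) (F₁ F₂ : FibreFunctor G) :
    DaggerBicategory.DaggerEquivalent (B := FunRepHilb G) F₁ F₂ ↔
      FibreFunctor.UnitarilyMonoidallyIsomorphic F₁ F₂ := by
  constructor
  · rintro ⟨X, Y, i, j, hi, hj⟩
    let X' : FibreFunctor.Trans F₁ F₂ := X.hom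
    let Y' : FibreFunctor.Trans F₂ F₁ := Y.hom
    -- Evaluate the unit 2-morphism at the only object; unitarity makes its dagger the inverse.
    let e : 𝟙_ FdHilb ≅ Y'.space ⊗ X'.space :=
      { hom := i.hom.modification.as.app (MonoidalSingleObj.star _)
        inv := (DaggerBicategory.dagger i).hom.modification.as.app (MonoidalSingleObj.star _)
        hom_inv_id := congrArg
          (fun s => s.hom.modification.as.app (MonoidalSingleObj.star _)) hi.1
        inv_hom_id := congrArg
          (fun s => s.hom.modification.as.app (MonoidalSingleObj.star _)) hi.2 }
    obtain ⟨u, hu⟩ := FdHilb.exists_unitary_unit (FdHilb.finrank_eq_one_of_iso e)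
    exact X'.unitarilyMonoidallyIsomorphic hu
  · rintro ⟨e, he, hu⟩
    have he' : NatTrans.IsMonoidal e.symm.hom := inferInstanceAs (NatTrans.IsMonoidal e.inv)
    have hu' (V : RepCQG G) : IsUnitaryHom (e.symm.hom.app V) :=
      IsUnitaryHom.inv (e := e.app V) (hu V)
    -- The unit comes from `e⁻¹` followed by `e`. The counit is the dagger of the unit 2-morphism
    -- for `e` followed by `e⁻¹`.
    exact ⟨_, _, _, _,
      FibreFunctor.Trans.isUnitary_unitOfIso he' he hu' hu fun V => e.inv_hom_id_app V,
      (FibreFunctor.Trans.isUnitary_unitOfIso he he' hu hu' fun V => e.hom_inv_id_app V).dagger⟩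

end
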